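/- Let $k$ be an algebraically closed field, let $Y'$ be a smooth irreducible projective curve over $k$, and let $\beta_0\colon X_0\to Y'$ be a connected cyclic étale cover of degree $m\ge 1$, i.e. a finite étale morphism of degree $m$ with $X_0$ connected, together with a $Y'$-automorphism $\tau$ of $X_0$ of order $m$ (a generator of the Galois group $\mathbb{Z}/m\mathbb{Z}$). Let $n\ge 1$ and let $p_1,\dots,p_n\in X_0(k)$ be general points; precisely, it is enough that the sets $\{p_i,\tau(p_i)\}$, $1\le i\le n$, are pairwise disjoint. Let $\nu\colon X_0\to X_1$ be the curve obtained from $X_0$ by gluing $p_i$ to $\tau(p_i)$ for every $i$: the underlying space of $X_1$ is the quotient of that of $X_0$ by the equivalence relation generated by $p_i\sim\tau(p_i)$, and $\mathcal{O}_{X_1}(U)$ consists of the $t\in\mathcal{O}_{X_0}(\nu^{-1}(U))$ with $t(p_i)=t(\tau(p_i))$ for all $i$ with $p_i\in\nu^{-1}(U)$ (for $m\ge 2$ this is a nodal curve with normalization $\nu$). Let $\beta_1\colon X_1\to Y'$ be the induced morphism, so that $\beta_1\circ\nu=\beta_0$. Then $\beta_1$ is primitive: for every geometric point $x$ of $X_1$,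 the homomorphism of étale fundamental groups $(\beta_1)_*\colon\pi_1(X_1,x)\to\pi_1(Y',\beta_1(x))$ is surjective. Moreover (this is the equivalent formulation of primitivity), for every finite étale morphism $Y''\to Y'$ with $Y''$ connected, the fibre product $X_1\times_{Y'}Y''$ is connected. -/

import Mathlib

open CategoryTheory CategoryTheory.Limits AlgebraicGeometry

universe u

noncomputable section

namespace EtalePi

/-- The class of finite étale morphisms of schemes. -/
def finiteEtale : MorphismProperty Scheme.{u} :=
  @IsFinite ⊓ @Etale

instance : finiteEtale.{u}.IsStableUnderBaseChange :=
  MorphismProperty.IsStableUnderBaseChange.inf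

/-- The category of finite étale covers of `X` (all `X`-morphisms as morphisms). -/
abbrev FEt (X : Scheme.{u}) := finiteEtale.{u}.Over ⊤ X

/-- The fibre functor at `x : Spec Ω ⟶ X`: it sends a finite étale cover `V ⟶ X` to the set of
geometric points of `V` above `x`. -/
def fiberFunctor {X : Scheme.{u}} {Ω : Type u} [Field Ω]
    (x : Spec (CommRingCat.of Ω) ⟶ X) : FEt X ⥤ Type u where
  obj V := {a : Spec (CommRingCat.of Ω) ⟶ V.left // a ≫ V.hom = x}
  map {V W} g := ↾fun a => ⟨a.1 ≫ g.left, by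
    rw [Category.assoc, MorphismProperty.Over.w g, a.2]⟩

/-- The étale fundamental group `π₁(X, x)`: the automorphism group of the fibre functor. -/
abbrev fundamentalGroup {X : Scheme.{u}} {Ω : Type u} [Field Ω]
    (x : Spec (CommRingCat.of Ω) ⟶ X) := Aut (fiberFunctor x)

/-- Base change of finite étale covers along `f`. -/
abbrev baseChange {X Y : Scheme.{u}} (f : X ⟶ Y) : FEt Y ⥤ FEt X :=
  MorphismProperty.Over.pullback finiteEtale.{u} ⊤ f

/-- The geometric points of `V ×[Y] X` above `x` are the geometric points of `V` above `f ∘ x`. -/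
def fiberEquiv {X Y : Scheme.{u}} (f : X ⟶ Y) {Ω : Type u} [Field Ω]
    (x : Spec (CommRingCat.of Ω) ⟶ X) {V : Scheme.{u}} (v : V ⟶ Y) :
    {a : Spec (CommRingCat.of Ω) ⟶ pullback v f // a ≫ pullback.snd v f = x} ≃
      {b : Spec (CommRingCat.of Ω) ⟶ V // b ≫ v = x ≫ f} where
  toFun a := ⟨a.1 ≫ pullback.fst v f, by
    rw [Category.assoc, pullback.condition, ← Category.assoc, a.2]⟩
  invFun b := ⟨pullback.lift b.1 x b.2, pullback.lift_snd _ _ _⟩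
  left_inv a := by
    apply Subtype.ext
    apply pullback.hom_ext
    · exact pullback.lift_fst _ _ _
    · exact (pullback.lift_snd _ _ _).trans a.2.symm
  right_inv b := Subtype.ext (pullback.lift_fst _ _ _)

/-- The identification `F_x ∘ f^* ≅ F_{f ∘ x}` of fibre functors. -/
def fiberIso {X Y : Scheme.{u}} (f : X ⟶ Y) {Ω : Type u} [Field Ω]
    (x : Spec (CommRingCat.of Ω) ⟶ X) :
    baseChange f ⋙ fiberFunctor x ≅ fiberFunctor (x ≫ f) :=
  NatIso.ofComponents (fun V => (fiberEquiv f x V.hom).toIso) (by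
    intro V W g
    ext a
    apply Subtype.ext
    have h : ((baseChange f).map g).left ≫ pullback.fst W.hom f =
      pullback.fst V.hom f ≫ g.left := pullback.lift_fst _ _ _
    exact (Category.assoc _ _ _).trans ((congrArg (a.1 ≫ ·) h).trans (Category.assoc _ _ _).symm))

/-- The homomorphism `f_* : π₁(X, x) → π₁(Y, f ∘ x)`: an automorphism of `F_x` is restricted to the
covers of the form `f^* V` and transported along `F_x (f^* V) ≅ F_{f ∘ x} (V)`. -/
def fundamentalGroupMap {X Y : Scheme.{u}} (f : X ⟶ Y) {Ω : Type u} [Field Ω]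
    (x : Spec (CommRingCat.of Ω) ⟶ X) :
    fundamentalGroup x →* fundamentalGroup (x ≫ f) where
  toFun σ := (fiberIso f x).symm ≪≫ Functor.isoWhiskerLeft (baseChange f) σ ≪≫ fiberIso f x
  map_one' := by
    apply Iso.ext
    ext V : 2
    change (fiberIso f x).inv.app V ≫ 𝟙 _ ≫ (fiberIso f x).hom.app V = 𝟙 _
    simp
  map_mul' σ ρ := by
    apply Iso.ext
    ext V : 2
    change (fiberIso f x).inv.app V ≫ (ρ.hom.app _ ≫ σ.hom.app _) ≫ (fiberIso f x).hom.app V =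
      ((fiberIso f x).inv.app V ≫ ρ.hom.app _ ≫ (fiberIso f x).hom.app V) ≫
        (fiberIso f x).inv.app V ≫ σ.hom.app _ ≫ (fiberIso f x).hom.app V
    simp

/-- `f : X ⟶ Y` is primitive if `f_*` is surjective on étale fundamental groups, for every
geometric base point of `X`. -/
def IsPrimitive {X Y : Scheme.{u}} (f : X ⟶ Y) : Prop :=
  ∀ (Ω : Type u) [Field Ω] [IsAlgClosed Ω] (x : Spec (CommRingCat.of Ω) ⟶ X),
    Function.Surjective (fundamentalGroupMap f x)

/-- `β : X ⟶ Y` is a (connected) cyclic étale cover of degree `m`, with Galois group the cyclic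
group of order `m` generated by the `Y`-automorphism `τ` of `X`. -/
structure IsCyclicEtaleCover {X Y : Scheme.{u}} (β : X ⟶ Y) (τ : Aut (Over.mk β)) (m : ℕ) :
    Prop where
  isFinite : IsFinite β
  etale : Etale β
  connected : ConnectedSpace X
  degree_eq : ∀ y : Y, β.finrank y = m
  orderOf_eq : orderOf τ = m

/-- `ν : X ⟶ Z` exhibits `Z` as the scheme obtained from `X` by gluing the `k`-point `p i` to the
`k`-point `q i` for every `i`: the underlying space of `Z` is the quotient of that of `X` by the
equivalence relation generated by `p i ∼ q i`, and, via `ν`, the sections of the structure sheaf of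
`Z` over `U` are the sections `t` of that of `X` over `ν⁻¹ U` with `t (p i) = t (q i)` whenever
`p i` and `q i` lie in `ν⁻¹ U`. -/
structure IsGluing {k : Type u} [Field k] {X Z : Scheme.{u}} {ι : Type}
    (p q : ι → (Spec (CommRingCat.of k) ⟶ X)) (ν : X ⟶ Z) : Prop where
  isQuotientMap : Topology.IsQuotientMap ν
  apply_eq_iff : ∀ a b : X, ν a = ν b ↔
    Relation.EqvGen (fun a b => ∃ i, a = p i (IsLocalRing.closedPoint k) ∧
      b = q i (IsLocalRing.closedPoint k)) a b
  app_injective : ∀ U : Z.Opens, Function.Injective (ν.app U)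
  mem_range_app_iff : ∀ (U : Z.Opens) (t : Γ(X, ν ⁻¹ᵁ U)), t ∈ Set.range (ν.app U) ↔
    ∀ (i : ι) (hp : ⊤ ≤ p i ⁻¹ᵁ (ν ⁻¹ᵁ U)) (hq : ⊤ ≤ q i ⁻¹ᵁ (ν ⁻¹ᵁ U)),
      (p i).appLE (ν ⁻¹ᵁ U) ⊤ hp t = (q i).appLE (ν ⁻¹ᵁ U) ⊤ hq t

end EtalePi

end

/-! Connectedness of the base change comes first. Let `T` be clopen in X₁ ×_{Y'} Y'', and `T₀` its
preimage in W₀ = X₀ ×_{Y'} Y'', on which τ acts through the first factor. The symmetric difference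
of `T₀` and its τ-preimage is clopen in W₀, a finite étale cover of the connected X₀; if nonempty,
it would meet the fibre over a glued point p. But there w and τw have the same image in X₁ ×_{Y'}
Y'', since ν(p) = ν(τp). So `T₀` is τ-invariant. Now view W₀ over the connected Y'': if `T₀` and its
complement were both nonempty, each would meet one common geometric fibre, on which the powers of τ
are transitive (`IsCyclicEtaleCover.exists_pow`), a contradiction. This is
`connectedSpace_pullback`.

Surjectivity on π₁ then follows by Galois theory: an automorphism σ of the fibre functor on covers
of Y must extend to all covers of X. On finitely many covers, the extension comes from moving a base
point of a connected dominating cover of X so that it lies over the σ-translate of a point of a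
connected pullback (`exists_isoWhiskerLeft_eq`). Since fibres are finite, these partial extensions
have a limit along an ultrafilter. -/

namespace EtalePi

/-! ### Geometric points of finite étale covers -/

/-- Two lifts of a morphism from a connected scheme along a separated unramified morphism agree as
soon as they agree after composition with a morphism from some nonempty scheme. -/
theorem eq_of_comp_eq {S A V T : Scheme.{u}} (v : V ⟶ S) [FormallyUnramified v]
    [LocallyOfFiniteType v] [IsSeparated v] [PreconnectedSpace A] {g h : A ⟶ V}
    (H : g ≫ v = h ≫ v) [Nonempty T] (a : T ⟶ A) (ha : a ≫ g = a ≫ h) : g = h := by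
  let l := pullback.lift g h H
  -- `e` is the equalizer of `g` and `h`: an open immersion because `v` is unramified, closed
  -- because `v` is separated.
  let e := pullback.fst l (pullback.diagonal v)
  have hcond : e ≫ l = pullback.snd l (pullback.diagonal v) ≫ pullback.diagonal v :=
    pullback.condition
  have hs : Surjective e := by
    have hr : IsClopen (Set.range e) := ⟨e.isClosedEmbedding.isClosed_range,
      e.isOpenEmbedding.isOpen_range⟩
    refine ⟨Set.range_eq_univ.mp (hr.eq_univ ?_)⟩
    have w : a ≫ l = (a ≫ g) ≫ pullback.diagonal v := by
      apply pullback.hom_ext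
      · rw [Category.assoc, Category.assoc, pullback.lift_fst, pullback.diagonal_fst,
          Category.comp_id]
      · rw [Category.assoc, Category.assoc, pullback.lift_snd, pullback.diagonal_snd,
          Category.comp_id, ha]
    obtain ⟨t⟩ := ‹Nonempty T›
    exact ⟨_, pullback.lift a (a ≫ g) w t, rfl⟩
  have : IsIso e := (isIso_iff_isOpenImmersion_and_surjective e).mpr ⟨inferInstance, hs⟩
  rw [← cancel_epi e]
  have h1 := congr($hcond ≫ pullback.fst _ _)
  have h2 := congr($hcond ≫ pullback.snd _ _)
  simp only [Category.assoc, l, pullback.lift_fst, pullback.lift_snd, pullback.diagonal_fst,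
    pullback.diagonal_snd] at h1 h2
  exact h1.trans h2.symm

/-- A nonempty clopen subset of a finite étale cover of a connected scheme meets every geometric
fibre. -/
theorem exists_point_mem {X V : Scheme.{u}} (f : V ⟶ X) [IsFinite f] [Etale f]
    [PreconnectedSpace X] {U : Set V} (hU : IsClopen U) (hne : U.Nonempty) {Ω : Type u} [Field Ω]
    [IsAlgClosed Ω] (x : Spec (CommRingCat.of Ω) ⟶ X) :
    ∃ a : Spec (CommRingCat.of Ω) ⟶ V, a ≫ f = x ∧ ∀ t, a t ∈ U := by
  have himg : f '' U = Set.univ :=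
    IsClopen.eq_univ ⟨f.isClosedMap _ hU.isClosed, f.isOpenMap _ hU.isOpen⟩ (hne.image f)
  obtain ⟨v, hvU, hv⟩ : x (IsLocalRing.closedPoint Ω) ∈ f '' U := himg ▸ Set.mem_univ _
  obtain ⟨w, hw, -⟩ := Scheme.Pullback.exists_preimage_pullback (f := f) (g := x) v
    (IsLocalRing.closedPoint Ω) hv
  -- The geometric fibre is quasi-compact, so its nonempty closed subset contains a closed point,
  -- which is rational since `Ω` is algebraically closed.
  have : CompactSpace ↥(pullback f x) :=
    QuasiCompact.compactSpace_of_compactSpace (pullback.snd f x)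
  have hC : IsClosed (pullback.fst f x ⁻¹' U) := hU.isClosed.preimage (pullback.fst f x).continuous
  obtain ⟨z, hz, hzc⟩ := hC.exists_closed_singleton ⟨w, by rwa [Set.mem_preimage, hw]⟩
  refine ⟨pointOfClosedPoint (pullback.snd f x) z hzc ≫ pullback.fst f x, ?_, ?_⟩
  · rw [Category.assoc, pullback.condition, pointOfClosedPoint_comp_assoc]
  · intro t
    rw [Scheme.Hom.comp_apply, pointOfClosedPoint_apply]
    exact hz

/-- A geometric point of `V` above `x` is determined by the point of `V ×[X] Spec Ω` it defines. -/
theorem point_ext {X V : Scheme.{u}} (f : V ⟶ X) [LocallyOfFiniteType f] {Ω : Type u} [Field Ω]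
    [IsAlgClosed Ω] {x : Spec (CommRingCat.of Ω) ⟶ X}
    {a b : Spec (CommRingCat.of Ω) ⟶ V} (ha : a ≫ f = 𝟙 _ ≫ x) (hb : b ≫ f = 𝟙 _ ≫ x)
    (h : pullback.lift a (𝟙 _) ha (IsLocalRing.closedPoint Ω) =
      pullback.lift b (𝟙 _) hb (IsLocalRing.closedPoint Ω)) : a = b := by
  have := ext_of_apply_closedPoint_eq (pullback.snd f x) (pullback.lift_snd _ _ ha)
    (pullback.lift_snd _ _ hb) h
  rw [← pullback.lift_fst _ _ ha, this, pullback.lift_fst]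

theorem finite_points {X V : Scheme.{u}} (f : V ⟶ X) [IsFinite f] {Ω : Type u} [Field Ω]
    [IsAlgClosed Ω] (x : Spec (CommRingCat.of Ω) ⟶ X) :
    Finite {a : Spec (CommRingCat.of Ω) ⟶ V // a ≫ f = x} := by
  have : Finite ↥(pullback f x) := by
    rw [← Set.finite_univ_iff]
    exact ((pullback.snd f x).finite_preimage (Set.toFinite Set.univ)).subset (by simp)
  refine Finite.of_injective (fun a : {a // a ≫ f = x} =>
    pullback.lift a.1 (𝟙 _) (by rw [a.2, Category.id_comp]) (IsLocalRing.closedPoint Ω)) ?_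
  intro a b hab
  exact Subtype.ext (point_ext f _ _ hab)

/-- Dedekind: distinct algebra maps `S → R` are linearly independent, so there are at most dim `S`
of them. -/
theorem card_sections_le_finrank {R S : Type u} [Field R] [CommRing S]
    (φ : CommRingCat.of R ⟶ CommRingCat.of S) (hφ : φ.hom.Finite) :
    Nat.card {a : Spec (CommRingCat.of R) ⟶ Spec (CommRingCat.of S) // a ≫ Spec.map φ = 𝟙 _} ≤
      (Spec.map φ).finrank (IsLocalRing.closedPoint R) := by
  algebraize [φ.hom]
  have hfin : Module.Finite R S := hφ
  have hφ' : φ = CommRingCat.ofHom (algebraMap R S) := rfl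
  rw [hφ', Scheme.Hom.finrank_SpecMap_algebraMap, Module.rankAtStalk_eq_finrank_of_free]
  have hc := cardinalMk_algHom R S R
  have hdual : Module.finrank R (S →ₗ[R] R) = Module.finrank R S := Subspace.dual_finrank_eq
  have hfin' : Finite (S →ₐ[R] R) := Cardinal.mk_lt_aleph0_iff.mp
    (hc.trans_lt (Cardinal.natCast_lt_aleph0))
  have hc' : Nat.card (S →ₐ[R] R) ≤ Module.finrank R S := by
    rw [← hdual, ← Nat.cast_le (α := Cardinal), Nat.cast_card]
    exact hc
  refine le_trans (Nat.card_le_card_of_injective (fun a => (⟨(Spec.preimage a.1).hom, ?_⟩ :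
    S →ₐ[R] R)) ?_) hc'
  · intro r
    have h : Spec.map (CommRingCat.ofHom (algebraMap R S) ≫ Spec.preimage a.1) =
      Spec.map (𝟙 _) := by
      rw [Spec.map_comp, Spec.map_preimage, a.2, Spec.map_id]
    exact congr(($(Spec.map_injective h)).hom r)
  · intro a b hab
    have h : (Spec.preimage a.1).hom = (Spec.preimage b.1).hom :=
      congrArg AlgHom.toRingHom hab
    exact Subtype.ext (by
      rw [← Spec.map_preimage a.1, ← Spec.map_preimage b.1, CommRingCat.hom_ext h])

/-- The number of geometric points of a fibre of a finite flat morphism is at most its degree. -/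
theorem card_points_le_finrank {X V : Scheme.{u}} (f : V ⟶ X) [IsFinite f] [Flat f] {Ω : Type u}
    [Field Ω] [IsAlgClosed Ω] (x : Spec (CommRingCat.of Ω) ⟶ X) :
    Nat.card {a : Spec (CommRingCat.of Ω) ⟶ V // a ≫ f = x} ≤
      f.finrank (x (IsLocalRing.closedPoint Ω)) := by
  let g := pullback.snd f x
  have : IsAffine (pullback f x) := isAffine_of_isAffineHom g
  let e := (pullback f x).isoSpec
  let φ := Spec.preimage (e.inv ≫ g)
  have hφ : Spec.map φ = e.inv ≫ g := Spec.map_preimage _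
  have hfin : φ.hom.Finite := by
    rw [← IsFinite.SpecMap_iff, hφ]
    infer_instance
  have hrank : (Spec.map φ).finrank (IsLocalRing.closedPoint Ω) =
      f.finrank (x (IsLocalRing.closedPoint Ω)) := by
    rw [hφ, Scheme.Hom.finrank_comp_left_of_isIso]
    exact Scheme.Hom.finrank_pullback_snd f x _
  rw [← hrank]
  have : IsFinite (Spec.map φ) := (IsFinite.SpecMap_iff φ).mpr hfin
  have := finite_points (Spec.map φ) (𝟙 _)
  have hsec (a : {a // a ≫ f = x}) : (pullback.lift a.1 (𝟙 _) (by rw [a.2, Category.id_comp]) ≫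
      e.hom) ≫ Spec.map φ = 𝟙 _ := by
    rw [hφ, Category.assoc, e.hom_inv_id_assoc]
    exact pullback.lift_snd _ _ _
  refine le_trans (Nat.card_le_card_of_injective (fun a => ⟨_, hsec a⟩) ?_)
    (card_sections_le_finrank φ hfin)
  intro a b hab
  have h := congr($(congrArg Subtype.val hab) ≫ e.inv ≫ pullback.fst f x)
  simp only [Category.assoc, e.hom_inv_id_assoc] at h
  exact Subtype.ext ((pullback.lift_fst _ _ _).symm.trans (h.trans (pullback.lift_fst _ _ _)))

/-! ### The Galois action, gluing, and connectedness of the base change -/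

/-- The powers of the generator of the Galois group of a cyclic étale cover act transitively on
geometric fibres. -/
theorem IsCyclicEtaleCover.exists_pow {X Y : Scheme.{u}} {β : X ⟶ Y} {τ : Aut (Over.mk β)} {m : ℕ}
    (h : IsCyclicEtaleCover β τ m) {Ω : Type u} [Field Ω] [IsAlgClosed Ω]
    {p q : Spec (CommRingCat.of Ω) ⟶ X} (hpq : p ≫ β = q ≫ β) :
    ∃ i : ℕ, q = p ≫ (τ ^ i).hom.left := by
  have := h.isFinite
  have := h.etale
  have := h.connected
  have hw (i : ℕ) : (τ ^ i).hom.left ≫ β = β := Over.w (τ ^ i).hom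
  have := finite_points β (p ≫ β)
  let F : Fin m → {a // a ≫ β = p ≫ β} :=
    fun i => ⟨p ≫ (τ ^ (i : ℕ)).hom.left, by rw [Category.assoc, hw]⟩
  -- By rigidity the `m` powers of `τ` send `p` to `m` distinct points, while the fibre has at most
  -- `m`.
  have hF : Function.Injective F := by
    intro i j hij
    have h1 : (τ ^ (i : ℕ)).hom.left = (τ ^ (j : ℕ)).hom.left :=
      eq_of_comp_eq (A := X) (V := X) β (by rw [hw, hw]) p (congrArg Subtype.val hij)
    have h2 : τ ^ (i : ℕ) = τ ^ (j : ℕ) := Iso.ext (Over.OverMorphism.ext h1)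
    exact Fin.ext (pow_injOn_Iio_orderOf (by simp [h.orderOf_eq]) (by simp [h.orderOf_eq]) h2)
  have hcard : Nat.card {a // a ≫ β = p ≫ β} ≤ Nat.card (Fin m) := by
    have := card_points_le_finrank β (p ≫ β)
    rwa [h.degree_eq, ← Nat.card_fin m] at this
  obtain ⟨i, hi⟩ := (hF.bijective_of_nat_card_le hcard).2 ⟨q, hpq.symm⟩
  exact ⟨i, (congrArg Subtype.val hi).symm⟩

/-- After gluing, the glued points coincide as morphisms from `Spec k`. -/
theorem IsGluing.comp_eq {k : Type u} [Field k] {X Z : Scheme.{u}} {ι : Type}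
    {p q : ι → (Spec (CommRingCat.of k) ⟶ X)} {ν : X ⟶ Z} (h : IsGluing p q ν) (i : ι) :
    p i ≫ ν = q i ≫ ν := by
  have hpt (t : Spec (CommRingCat.of k)) : (p i ≫ ν) t = (q i ≫ ν) t := by
    obtain rfl : t = IsLocalRing.closedPoint k := Subsingleton.elim (α := PrimeSpectrum k) _ _
    exact (h.apply_eq_iff _ _).mpr (.rel _ _ ⟨i, rfl, rfl⟩)
  refine Scheme.Hom.ext (by ext t; exact hpt t) fun U => ?_
  have hU : (p i ≫ ν) ⁻¹ᵁ U = (q i ≫ ν) ⁻¹ᵁ U := by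
    ext t
    exact congr($(hpt t) ∈ U).to_iff
  -- On the one-point scheme every open is `⊤` or `⊥`; only `⊤` needs the gluing condition on
  -- sections.
  by_cases hz : (q i ≫ ν) ⁻¹ᵁ U = ⊤
  · have hq : (⊤ : (Spec (CommRingCat.of k)).Opens) ≤ (q i ≫ ν) ⁻¹ᵁ U := hz.ge
    have hp : (⊤ : (Spec (CommRingCat.of k)).Opens) ≤ (p i ≫ ν) ⁻¹ᵁ U := hU ▸ hq
    have key : (p i ≫ ν).appLE U ⊤ hp = (q i ≫ ν).appLE U ⊤ hq := by
      rw [Scheme.Hom.comp_appLE, Scheme.Hom.comp_appLE]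
      ext s
      exact (h.mem_range_app_iff U (ν.app U s)).mp ⟨s, rfl⟩ i hp hq
    rw [Scheme.Hom.app_eq_appLE, Scheme.Hom.app_eq_appLE, Scheme.Hom.appLE_map]
    have := congr($key ≫ (Spec (CommRingCat.of k)).presheaf.map (eqToHom hz).op)
    rwa [Scheme.Hom.appLE_map, Scheme.Hom.appLE_map] at this
  · have hb : (q i ≫ ν) ⁻¹ᵁ U = ⊥ := by
      ext t
      refine iff_of_false (fun ht => hz ?_) (by simp)
      ext t'
      obtain rfl : t = t' := Subsingleton.elim (α := PrimeSpectrum k) _ _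
      exact iff_of_true ht trivial
    ext s
    have : Subsingleton Γ(Spec (CommRingCat.of k), (q i ≫ ν) ⁻¹ᵁ U) := by
      rw [hb]; infer_instance
    exact Subsingleton.elim _ _

/-- If `ν : X₀ ⟶ X₁` is surjective, `ν ≫ β₁` is a cyclic étale cover with generator `τ`, and `ν`
identifies one geometric point `p` with `τ p`, then base change along `β₁` preserves connectedness
of finite étale covers. -/
theorem connectedSpace_pullback {Y X₀ X₁ : Scheme.{u}} [PreconnectedSpace Y] {m : ℕ} {β₀ : X₀ ⟶ Y}
    {τ : Aut (Over.mk β₀)} (hβ₀ : IsCyclicEtaleCover β₀ τ m) {k : Type u} [Field k] [IsAlgClosed k]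
    (p : Spec (CommRingCat.of k) ⟶ X₀) {ν : X₀ ⟶ X₁} [Surjective ν]
    (hp : p ≫ ν = (p ≫ τ.hom.left) ≫ ν) {β₁ : X₁ ⟶ Y} (hβ₁ : ν ≫ β₁ = β₀) {Y'' : Scheme.{u}}
    (γ : Y'' ⟶ Y) [IsFinite γ] [Etale γ] [ConnectedSpace Y''] :
    ConnectedSpace ↥(pullback β₁ γ) := by
  have := hβ₀.isFinite
  have := hβ₀.etale
  have := hβ₀.connected
  have hτ : τ.hom.left ≫ β₀ = β₀ := Over.w τ.hom
  let W₀ := pullback β₀ γ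
  let νW : W₀ ⟶ pullback β₁ γ := pullback.lift (pullback.fst β₀ γ ≫ ν) (pullback.snd β₀ γ)
    (by rw [Category.assoc, hβ₁, pullback.condition])
  have hνW₁ : νW ≫ pullback.fst β₁ γ = pullback.fst β₀ γ ≫ ν := pullback.lift_fst _ _ _
  have hνW₂ : νW ≫ pullback.snd β₁ γ = pullback.snd β₀ γ := pullback.lift_snd _ _ _
  let τW : W₀ ⟶ W₀ := pullback.lift (pullback.fst β₀ γ ≫ τ.hom.left) (pullback.snd β₀ γ)
    (by rw [Category.assoc, hτ, pullback.condition])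
  have hτW₁ : τW ≫ pullback.fst β₀ γ = pullback.fst β₀ γ ≫ τ.hom.left := pullback.lift_fst _ _ _
  have hτW₂ : τW ≫ pullback.snd β₀ γ = pullback.snd β₀ γ := pullback.lift_snd _ _ _
  have hνW : Surjective νW := by
    -- `νW` is surjective as a base change of `ν`; `l` lifts that base change through W₀.
    let l : pullback ν (pullback.fst β₁ γ) ⟶ W₀ := pullback.lift (pullback.fst _ _)
      (pullback.snd _ _ ≫ pullback.snd _ _) (by
        rw [← hβ₁, pullback.condition_assoc, pullback.condition, Category.assoc])
    have hl : l ≫ νW = pullback.snd _ _ := by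
      apply pullback.hom_ext
      · rw [Category.assoc, hνW₁, pullback.lift_fst_assoc, pullback.condition]
      · rw [Category.assoc, hνW₂, pullback.lift_snd]
    have : Surjective (l ≫ νW) := hl ▸ inferInstance
    exact .of_comp l νW
  obtain ⟨b, hb, -⟩ := exists_point_mem γ isClopen_univ Set.univ_nonempty (p ≫ β₀)
  let t₀ : Spec (CommRingCat.of k) := IsLocalRing.closedPoint k
  have hne : Nonempty ↥(pullback β₁ γ) := ⟨νW (pullback.lift p b hb.symm t₀)⟩
  suffices PreconnectedSpace ↥(pullback β₁ γ) from { toNonempty := hne }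
  rw [preconnectedSpace_iff_clopen]
  intro T hT
  let T₀ : Set W₀ := νW ⁻¹' T
  have hT₀ : IsClopen T₀ := hT.preimage νW.continuous
  have hinv (w : W₀) : w ∈ T₀ ↔ τW w ∈ T₀ := by
    have hτT₀ : IsClopen (τW ⁻¹' T₀) := hT₀.preimage τW.continuous
    have hD : IsClopen (symmDiff T₀ (τW ⁻¹' T₀)) :=
      (hT₀.diff hτT₀).union (hτT₀.diff hT₀)
    by_contra hw
    obtain ⟨a, ha, haD⟩ := exists_point_mem (pullback.fst β₀ γ) hD ⟨w, by
      rw [Set.mem_symmDiff, Set.mem_preimage]; tauto⟩ p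
    have haτ : a ≫ τW ≫ νW = a ≫ νW := by
      apply pullback.hom_ext
      · rw [Category.assoc, Category.assoc, hνW₁, reassoc_of% hτW₁, reassoc_of% ha, Category.assoc,
          hνW₁, reassoc_of% ha, hp, Category.assoc]
      · rw [Category.assoc, Category.assoc, hνW₂, hτW₂, Category.assoc, hνW₂]
    have h1 : νW (τW (a t₀)) = νW (a t₀) := congr($haτ t₀)
    have h2 := haD t₀
    rw [Set.mem_symmDiff, Set.mem_preimage, Set.mem_preimage, Set.mem_preimage, h1] at h2
    tauto
  by_contra! hcon
  obtain ⟨⟨w, hw⟩, hw'⟩ := hcon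
  obtain ⟨w', hw'⟩ := (Set.ne_univ_iff_exists_notMem T).mp hw'
  obtain ⟨v, rfl⟩ := νW.surjective w
  obtain ⟨v', rfl⟩ := νW.surjective w'
  obtain ⟨c, hc, hcT⟩ := exists_point_mem (pullback.snd β₀ γ) hT₀ ⟨v, hw⟩ b
  obtain ⟨c', hc', hcT'⟩ := exists_point_mem (pullback.snd β₀ γ) hT₀.compl ⟨v', hw'⟩ b
  obtain ⟨i, hi⟩ := hβ₀.exists_pow (p := c ≫ pullback.fst β₀ γ) (q := c' ≫ pullback.fst β₀ γ) (by
    rw [Category.assoc, Category.assoc, pullback.condition, reassoc_of% hc, reassoc_of% hc'])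
  have horbit (j : ℕ) : ∃ e : Spec (CommRingCat.of k) ⟶ W₀,
      e ≫ pullback.fst β₀ γ = (c ≫ pullback.fst β₀ γ) ≫ (τ ^ j).hom.left ∧
        e ≫ pullback.snd β₀ γ = b ∧ ∀ t, e t ∈ T₀ := by
    induction j with
    | zero => exact ⟨c, (Category.comp_id _).symm, hc, hcT⟩
    | succ j ih =>
      obtain ⟨e, he₁, he₂, heT⟩ := ih
      refine ⟨e ≫ τW, ?_, ?_, fun t => (hinv _).mp (heT t)⟩
      · have hpow : (τ ^ (j + 1)).hom.left = (τ ^ j).hom.left ≫ τ.hom.left := by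
          rw [pow_succ']; rfl
        rw [Category.assoc, hτW₁, reassoc_of% he₁, hpow, Category.assoc]
      · rw [Category.assoc, hτW₂, he₂]
  obtain ⟨e, he₁, he₂, heT⟩ := horbit i
  obtain rfl : e = c' := pullback.hom_ext (he₁.trans hi.symm) (he₂.trans hc'.symm)
  exact hcT' t₀ (heT t₀)

/-! ### Extending automorphisms of fibre functors -/

section LiftAutomorphism

universe w v₁ v₂ u₁ u₂

variable {C : Type u₁} [Category.{v₁} C] {D : Type u₂} [Category.{v₂} D] (F : D ⥤ Type w)
  (H : C ⥤ D)

/-- Compactness: an automorphism of `H ⋙ F` extends to an automorphism of the functor `F` with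
finite values as soon as it extends over each finite family of objects. -/
theorem exists_isoWhiskerLeft_eq_of_finite [∀ V, Finite (F.obj V)] (σ : H ⋙ F ≅ H ⋙ F)
    (h : ∀ (S : Finset D) (R : Finset C), ∃ ρ : ∀ V, F.obj V → F.obj V,
      (∀ V ∈ S, Function.Injective (ρ V)) ∧
      (∀ V ∈ S, ∀ W ∈ S, ∀ (g : V ⟶ W) (v : F.obj V), ρ W (F.map g v) = F.map g (ρ V v)) ∧
      ∀ W ∈ R, H.obj W ∈ S → ∀ w, ρ (H.obj W) w = σ.hom.app W w) :
    ∃ ρ : F ≅ F, Functor.isoWhiskerLeft H ρ = σ := by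
  classical
  choose r hinj hnat hext using h
  let 𝒱 : Ultrafilter (Finset D × Finset C) := Ultrafilter.of Filter.atTop
  let 𝒰 : Filter (Finset D × Finset C) := 𝒱
  have h𝒰 : 𝒰 ≤ Filter.atTop := Ultrafilter.of_le _
  have hD (V : D) : ∀ᶠ I in 𝒰, V ∈ I.1 :=
    h𝒰 (Filter.mem_of_superset (Filter.mem_atTop (({V}, ∅) : Finset D × Finset C))
      fun I hI => hI.1 (Finset.mem_singleton_self V))
  have hC (W : C) : ∀ᶠ I in 𝒰, W ∈ I.2 :=
    h𝒰 (Filter.mem_of_superset (Filter.mem_atTop ((∅, {W}) : Finset D × Finset C))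
      fun I hI => hI.2 (Finset.mem_singleton_self W))
  -- `F.obj V` has only finitely many self-maps, so the partial extensions are constant along the
  -- ultrafilter.
  have hlim (V : D) : ∃ ρ : F.obj V → F.obj V, ∀ᶠ I in 𝒰, r I.1 I.2 V = ρ :=
    (Ultrafilter.eventually_exists_iff (f := 𝒱)).mp (Filter.Eventually.of_forall fun I => ⟨_, rfl⟩)
  choose ρ hρ using hlim
  have hρinj (V : D) : Function.Injective (ρ V) := by
    obtain ⟨I, hI, hV⟩ := ((hρ V).and (hD V)).exists
    exact hI ▸ hinj I.1 I.2 V hV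
  have hρnat {V W : D} (g : V ⟶ W) (v : F.obj V) : ρ W (F.map g v) = F.map g (ρ V v) := by
    obtain ⟨I, hI, hI', hV, hW⟩ := ((hρ V).and ((hρ W).and ((hD V).and (hD W)))).exists
    rw [← hI, ← hI']
    exact hnat I.1 I.2 V hV W hW g v
  have hρext (W : C) (w : F.obj (H.obj W)) : ρ (H.obj W) w = σ.hom.app W w := by
    obtain ⟨I, hI, hV, hW⟩ := ((hρ (H.obj W)).and ((hD (H.obj W)).and (hC W))).exists
    rw [← hI]
    exact hext I.1 I.2 W hW hV w
  refine ⟨NatIso.ofComponents (fun V =>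
    (Equiv.ofBijective (ρ V) (Finite.injective_iff_bijective.mp (hρinj V))).toIso) ?_, ?_⟩
  · intro V W g
    ext v
    exact hρnat g v
  · ext W w
    exact hρext W w

/-- An automorphism of `H ⋙ F` extends to an automorphism of `F`, if there is a notion of connected
object (`P`) of `D` such that morphisms out of connected objects are determined by one point, those
into connected objects are surjective on points, and both in `D` and (after applying `H`) in `C`
finitely many pointed objects are dominated by a connected one. -/
theorem exists_isoWhiskerLeft_eq [∀ V, Finite (F.obj V)] (P : D → Prop)
    (hrigid : ∀ {A V : D}, P A → ∀ (g h : A ⟶ V) (a : F.obj A), F.map g a = F.map h a → g = h)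
    (hsurj : ∀ {A B : D}, P B → Nonempty (F.obj A) → ∀ g : A ⟶ B, Function.Surjective (F.map g))
    (hdomD : ∀ S : Finset (Σ V : D, F.obj V), ∃ (A : D) (a : F.obj A), P A ∧
      ∀ s ∈ S, ∃ g : A ⟶ s.1, F.map g a = s.2)
    (hdomC : ∀ S : Finset (Σ W : C, F.obj (H.obj W)), ∃ (B : C) (b : F.obj (H.obj B)), P (H.obj B) ∧
      ∀ s ∈ S, ∃ g : B ⟶ s.1, F.map (H.map g) b = s.2)
    (σ : H ⋙ F ≅ H ⋙ F) : ∃ ρ : F ≅ F, Functor.isoWhiskerLeft H ρ = σ := by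
  classical
  refine exists_isoWhiskerLeft_eq_of_finite F H σ fun S R => ?_
  have (V : D) : Fintype (F.obj V) := Fintype.ofFinite _
  obtain ⟨B, b, hB, hBdom⟩ := hdomC (R.sigma fun _ => Finset.univ)
  obtain ⟨A, a, hA, hAdom⟩ := hdomD (insert ⟨H.obj B, b⟩ (S.sigma fun _ => Finset.univ))
  obtain ⟨π, hπ⟩ := hAdom _ (Finset.mem_insert_self _ _)
  -- `a'` is the intended image of the base point `a`: it must lie over `σ b`.
  obtain ⟨a', ha'⟩ := hsurj hB ⟨a⟩ π (σ.hom.app B b)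
  have hG (V : D) (hV : V ∈ S) (v : F.obj V) : ∃ g : A ⟶ V, F.map g a = v :=
    hAdom ⟨V, v⟩ (Finset.mem_insert_of_mem (Finset.mem_sigma.mpr ⟨hV, Finset.mem_univ _⟩))
  choose G hG using hG
  have hGeq {V : D} (hV : V ∈ S) {v : F.obj V} {g : A ⟶ V} (hg : F.map g a = v) : G V hV v = g :=
    hrigid hA _ _ a ((hG V hV v).trans hg.symm)
  -- Each `v` is the image of `a` under a unique morphism; it is sent to the image of `a'` under the
  -- same morphism. Outside `S` the value is irrelevant.
  refine ⟨fun V v => if hV : V ∈ S then F.map (G V hV v) a' else v, ?_, ?_, ?_⟩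
  · intro V hV v w hvw
    simp only [dif_pos hV] at hvw
    rw [← hG V hV v, hrigid hA _ _ a' hvw, hG V hV w]
  · intro V hV W hW g v
    simp only [dif_pos hV, dif_pos hW]
    rw [hGeq hW (g := G V hV v ≫ g) (by rw [Functor.map_comp_apply, hG]),
      Functor.map_comp_apply]
  · intro W hW hHW w
    simp only [dif_pos hHW]
    obtain ⟨g, hg⟩ := hBdom ⟨W, w⟩ (Finset.mem_sigma.mpr ⟨hW, Finset.mem_univ _⟩)
    rw [hGeq hHW (g := π ≫ H.map g) (by rw [Functor.map_comp_apply, hπ, hg]),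
      Functor.map_comp_apply, ha']
    have := NatTrans.naturality_apply σ.hom g b
    exact this.symm.trans (congrArg (σ.hom.app W) hg)

end LiftAutomorphism

/-! ### Connected covers and domination -/

section FiniteEtaleCovers

variable {X : Scheme.{u}} {Ω : Type u} [Field Ω] (x : Spec (CommRingCat.of Ω) ⟶ X)

instance (V : FEt X) : IsFinite V.hom := V.prop.1

instance (V : FEt X) : Etale V.hom := V.prop.2

theorem fiberFunctor_map_injective {A V : FEt X} [PreconnectedSpace A.left] (g h : A ⟶ V)
    (a : (fiberFunctor x).obj A) (hgh : (fiberFunctor x).map g a = (fiberFunctor x).map h a) :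
    g = h := by
  apply MorphismProperty.Over.Hom.ext
  exact eq_of_comp_eq V.hom ((MorphismProperty.Over.w g).trans (MorphismProperty.Over.w h).symm)
    a.1 (congrArg Subtype.val hgh)

variable [IsAlgClosed Ω]

instance (V : FEt X) : Finite ((fiberFunctor x).obj V) := finite_points V.hom x

theorem fiberFunctor_map_surjective {A B : FEt X} [PreconnectedSpace B.left]
    (hA : Nonempty ((fiberFunctor x).obj A)) (g : A ⟶ B) :
    Function.Surjective ((fiberFunctor x).map g) := by
  intro b
  have hw : g.left ≫ B.hom = A.hom := MorphismProperty.Over.w g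
  have : IsFinite (g.left ≫ B.hom) := by rw [hw]; infer_instance
  have : Etale (g.left ≫ B.hom) := by rw [hw]; infer_instance
  have : IsFinite g.left := .of_comp g.left B.hom
  have : Etale g.left := .of_comp g.left B.hom
  obtain ⟨a₀⟩ := hA
  obtain ⟨a, ha, -⟩ := exists_point_mem g.left isClopen_univ
    ⟨a₀.1 (IsLocalRing.closedPoint Ω), trivial⟩ b.1
  exact ⟨⟨a, by rw [← hw, ← Category.assoc, ha, b.2]⟩, Subtype.ext ha⟩

/-- A geometric point of a disconnected finite étale cover lies in a finite étale cover with fewer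
geometric points. -/
theorem exists_card_lt [PreconnectedSpace X] (V : FEt X) (v : (fiberFunctor x).obj V)
    (hV : ¬ PreconnectedSpace V.left) : ∃ (W : FEt X) (w : (fiberFunctor x).obj W) (g : W ⟶ V),
      (fiberFunctor x).map g w = v ∧
        Nat.card ((fiberFunctor x).obj W) < Nat.card ((fiberFunctor x).obj V) := by
  let t₀ : Spec (CommRingCat.of Ω) := IsLocalRing.closedPoint Ω
  obtain ⟨T, hT, hTne, hvT⟩ : ∃ T : Set V.left, IsClopen T ∧ Tᶜ.Nonempty ∧ v.1 t₀ ∈ T := by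
    rw [preconnectedSpace_iff_clopen] at hV
    push Not at hV
    obtain ⟨T, hT, hne, huniv⟩ := hV
    by_cases hv : v.1 t₀ ∈ T
    · exact ⟨T, hT, Set.nonempty_compl.mpr huniv, hv⟩
    · exact ⟨Tᶜ, hT.compl, by rwa [compl_compl], hv⟩
  let U : V.left.Opens := ⟨T, hT.isOpen⟩
  have : IsClosedImmersion U.ι := .of_isPreimmersion _ (by
    rw [Scheme.Opens.range_ι]; exact hT.isClosed)
  let W : FEt X := MorphismProperty.Over.mk ⊤ (U.ι ≫ V.hom)
    ⟨inferInstanceAs (IsFinite (U.ι ≫ V.hom)), inferInstanceAs (Etale (U.ι ≫ V.hom))⟩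
  let g : W ⟶ V := MorphismProperty.Over.homMk U.ι rfl
  have hr : Set.range v.1 ⊆ Set.range U.ι := by
    rintro _ ⟨t, rfl⟩
    obtain rfl : t = t₀ := Subsingleton.elim (α := PrimeSpectrum Ω) _ _
    rw [Scheme.Opens.range_ι]
    exact hvT
  let w₀ : Spec (CommRingCat.of Ω) ⟶ U := IsOpenImmersion.lift U.ι v.1 hr
  have hw₀ : w₀ ≫ U.ι = v.1 := IsOpenImmersion.lift_fac _ _ _
  let w : (fiberFunctor x).obj W := ⟨w₀, by
    change w₀ ≫ U.ι ≫ V.hom = x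
    rw [reassoc_of% hw₀, v.2]⟩
  refine ⟨W, w, g, Subtype.ext hw₀, ?_⟩
  have hinj : Function.Injective ((fiberFunctor x).map g) := by
    intro a b hab
    have h : a.1 ≫ U.ι = b.1 ≫ U.ι := congrArg Subtype.val hab
    exact Subtype.ext ((cancel_mono U.ι).mp h)
  by_contra! hle
  -- The removed part `Tᶜ` is clopen and nonempty, so it contains a point of the fibre that `W`
  -- misses.
  obtain ⟨a, ha, haT⟩ := exists_point_mem (X := X) V.hom hT.compl hTne x
  obtain ⟨b, hb⟩ := (hinj.bijective_of_nat_card_le hle).2 ⟨a, ha⟩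
  have hb' : b.1 ≫ U.ι = a := congrArg Subtype.val hb
  apply haT t₀
  rw [← hb']
  exact (b.1 t₀).2

/-- Every geometric point of a finite étale cover lies in a connected finite étale cover. -/
theorem exists_connected [PreconnectedSpace X] (V : FEt X) (v : (fiberFunctor x).obj V) :
    ∃ (A : FEt X) (a : (fiberFunctor x).obj A) (g : A ⟶ V), PreconnectedSpace A.left ∧
      (fiberFunctor x).map g a = v := by
  induction h : Nat.card ((fiberFunctor x).obj V) using Nat.strong_induction_on generalizing V with
  | _ n ih =>
    by_cases hV : PreconnectedSpace V.left
    · exact ⟨V, v, 𝟙 V, hV, by simp⟩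
    · obtain ⟨W, w, g, hg, hlt⟩ := exists_card_lt x V v hV
      obtain ⟨A, a, g', hA, hg'⟩ := ih _ (h ▸ hlt) W w rfl
      exact ⟨A, a, g' ≫ g, hA, by rw [Functor.map_comp_apply, hg', hg]⟩

/-- Finitely many pointed finite étale covers are dominated by a connected one. -/
theorem exists_connected_dominating [PreconnectedSpace X]
    (S : Finset (Σ V : FEt X, (fiberFunctor x).obj V)) :
    ∃ (A : FEt X) (a : (fiberFunctor x).obj A), PreconnectedSpace A.left ∧
      ∀ s ∈ S, ∃ g : A ⟶ s.1, (fiberFunctor x).map g a = s.2 := by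
  classical
  suffices ∃ (A : FEt X) (a : (fiberFunctor x).obj A),
      ∀ s ∈ S, ∃ g : A ⟶ s.1, (fiberFunctor x).map g a = s.2 by
    obtain ⟨V, v, hV⟩ := this
    obtain ⟨A, a, g, hA, hg⟩ := exists_connected x V v
    refine ⟨A, a, hA, fun s hs => ?_⟩
    obtain ⟨g', hg'⟩ := hV s hs
    exact ⟨g ≫ g', by rw [Functor.map_comp_apply, hg, hg']⟩
  induction S using Finset.induction_on with
  | empty =>
    exact ⟨MorphismProperty.Over.mk ⊤ (𝟙 X) ⟨inferInstanceAs (IsFinite (𝟙 X)),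
      inferInstanceAs (Etale (𝟙 X))⟩, ⟨x, Category.comp_id x⟩, by simp⟩
  | insert s S _ ih =>
    obtain ⟨A, a, hA⟩ := ih
    obtain ⟨V, v⟩ := s
    let W : FEt X := MorphismProperty.Over.mk ⊤ (pullback.fst A.hom V.hom ≫ A.hom)
      ⟨inferInstanceAs (IsFinite (pullback.fst A.hom V.hom ≫ A.hom)),
        inferInstanceAs (Etale (pullback.fst A.hom V.hom ≫ A.hom))⟩
    let g₁ : W ⟶ A := MorphismProperty.Over.homMk (pullback.fst A.hom V.hom) rfl
    let g₂ : W ⟶ V := MorphismProperty.Over.homMk (pullback.snd A.hom V.hom)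
      pullback.condition.symm
    have hav : a.1 ≫ A.hom = v.1 ≫ V.hom := a.2.trans v.2.symm
    let w : (fiberFunctor x).obj W := ⟨pullback.lift a.1 v.1 hav, by
      change _ ≫ pullback.fst A.hom V.hom ≫ A.hom = x
      rw [pullback.lift_fst_assoc, a.2]⟩
    have hw₁ : (fiberFunctor x).map g₁ w = a := Subtype.ext (pullback.lift_fst _ _ hav)
    have hw₂ : (fiberFunctor x).map g₂ w = v := Subtype.ext (pullback.lift_snd _ _ hav)
    refine ⟨W, w, fun s hs => ?_⟩
    obtain rfl | hs := Finset.mem_insert.mp hs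
    · exact ⟨g₂, hw₂⟩
    · obtain ⟨g, hg⟩ := hA s hs
      exact ⟨g₁ ≫ g, by rw [Functor.map_comp_apply, hw₁, hg]⟩

end FiniteEtaleCovers

/-! ### From connected base changes to surjectivity on π₁ -/

/-- A morphism of connected schemes such that the base change of every connected finite étale cover
is connected is surjective on étale fundamental groups. -/
theorem isPrimitive_of_connectedSpace_pullback {X Y : Scheme.{u}} [PreconnectedSpace X]
    [PreconnectedSpace Y] (f : X ⟶ Y)
    (h : ∀ (V : Scheme.{u}) (γ : V ⟶ Y) [IsFinite γ] [Etale γ] [ConnectedSpace V],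
      ConnectedSpace ↥(pullback f γ)) : IsPrimitive f := by
  intro Ω _ _ x σ
  classical
  have hdom (S : Finset (Σ W : FEt Y, (fiberFunctor x).obj ((baseChange f).obj W))) :
      ∃ (B : FEt Y) (b : (fiberFunctor x).obj ((baseChange f).obj B)),
        PreconnectedSpace ((baseChange f).obj B).left ∧
          ∀ s ∈ S, ∃ g : B ⟶ s.1, (fiberFunctor x).map ((baseChange f).map g) b = s.2 := by
    let φ (s : Σ W : FEt Y, (fiberFunctor x).obj ((baseChange f).obj W)) :
        Σ V : FEt Y, (fiberFunctor (x ≫ f)).obj V := ⟨s.1, (fiberIso f x).hom.app s.1 s.2⟩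
    obtain ⟨B, b, hB, hdom⟩ := exists_connected_dominating (x ≫ f) (S.image φ)
    refine ⟨B, (fiberIso f x).inv.app B b, ?_, fun s hs => ?_⟩
    · have : ConnectedSpace B.left := { toNonempty := ⟨b.1 (IsLocalRing.closedPoint Ω)⟩ }
      have := h B.left B.hom
      exact ((pullbackSymmetry f B.hom).hom.surjective.connectedSpace
        (pullbackSymmetry f B.hom).hom.continuous).toPreconnectedSpace
    · obtain ⟨g, hg⟩ := hdom _ (Finset.mem_image_of_mem _ hs)
      refine ⟨g, ?_⟩
      have hn := NatTrans.naturality_apply (fiberIso f x).inv g b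
      exact hn.symm.trans ((congrArg ((fiberIso f x).inv.app s.1) hg).trans
        (congr($((fiberIso f x).hom_inv_id_app s.1) s.2)))
  obtain ⟨ρ, hρ⟩ := exists_isoWhiskerLeft_eq (fiberFunctor x) (baseChange f)
    (fun V => PreconnectedSpace V.left)
    (fun hA g h a => have := hA; fiberFunctor_map_injective x g h a)
    (fun hB hA g => have := hB; fiberFunctor_map_surjective x hA g)
    (exists_connected_dominating x) hdom (fiberIso f x ≪≫ σ ≪≫ (fiberIso f x).symm)
  refine ⟨ρ, ?_⟩
  change (fiberIso f x).symm ≪≫ Functor.isoWhiskerLeft (baseChange f) ρ ≪≫ fiberIso f x = σ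
  rw [hρ]
  apply Iso.ext
  simp only [Iso.trans_hom, Iso.symm_hom, Category.assoc, Iso.inv_hom_id_assoc]
  exact (congrArg (σ.hom ≫ ·) (fiberIso f x).inv_hom_id).trans (Category.comp_id _)

end EtalePi

theorem proposition3p1 {k : Type u} [Field k] [IsAlgClosed k]
    {Y' X₀ X₁ : Scheme.{u}}
    -- `Y'` is a smooth irreducible projective curve over `k`
    (s : Y' ⟶ Spec (CommRingCat.of k)) [SmoothOfRelativeDimension 1 s] [IsProper s]
    [IrreducibleSpace Y']
    -- `β₀ : X₀ ⟶ Y'` is a cyclic étale cover of degree `m`, with group generated by `τ`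
    (m : ℕ) (β₀ : X₀ ⟶ Y') (τ : Aut (Over.mk β₀))
    (hβ₀ : EtalePi.IsCyclicEtaleCover β₀ τ m)
    -- `n ≥ 1` points of `X₀` such that the sets `{p i, τ (p i)}` are pairwise disjoint
    (n : ℕ) (hn : 0 < n) (p : Fin n → (Spec (CommRingCat.of k) ⟶ X₀))
    (hp : ∀ i, p i ≫ β₀ ≫ s = 𝟙 _)
    (hdisj : ∀ i j, i ≠ j → p i ≠ p j ∧ p i ≠ p j ≫ τ.hom.left)
    -- `X₁` is obtained from `X₀` by gluing `p i` to `τ (p i)`, and `β₁` is the induced map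
    (ν : X₀ ⟶ X₁) (hν : EtalePi.IsGluing p (fun i => p i ≫ τ.hom.left) ν)
    (β₁ : X₁ ⟶ Y') (hβ₁ : ν ≫ β₁ = β₀) :
    EtalePi.IsPrimitive β₁ ∧
      ∀ (Y'' : Scheme.{u}) (γ : Y'' ⟶ Y') [IsFinite γ] [Etale γ] [ConnectedSpace Y''],
        ConnectedSpace ↥(pullback β₁ γ) := by
  have : Surjective ν := ⟨hν.isQuotientMap.surjective⟩
  have : ConnectedSpace X₀ := hβ₀.connected
  have : ConnectedSpace X₁ := ν.surjective.connectedSpace ν.continuous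
  have hconn (Y'' : Scheme.{u}) (γ : Y'' ⟶ Y') [IsFinite γ] [Etale γ] [ConnectedSpace Y''] :
      ConnectedSpace ↥(pullback β₁ γ) :=
    EtalePi.connectedSpace_pullback hβ₀ (p ⟨0, hn⟩) (hν.comp_eq ⟨0, hn⟩) hβ₁ γ
  exact ⟨EtalePi.isPrimitive_of_connectedSpace_pullback β₁ hconn, hconn⟩
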